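/- Let $\mathbf{t} = t_0t_1t_2\cdots = 01101001\cdots$ be the Thue–Morse word, i.e., $t_n \in \{0,1\}$ is the parity of the number of $1$'s in the binary expansion of $n$. For $n \ge 0$ let $c(n)$ denote its cyclic complexity: the number of length-$n$ factors (blocks of $n$ consecutive letters) of $\mathbf{t}$, where factors that are cyclic shifts of each other are counted only once. Then $$\liminf_{n\to\infty} \frac{c(n)}{n} = \frac{4}{3}.$$ -/

import Mathlib

/-- The Thue–Morse word `t = 01101001⋯`: the `n`-th letter (`n = 0, 1, 2, …`) is the parity of
the number of ones in the binary expansion of `n`. -/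
def thueMorse (n : ℕ) : Fin 2 :=
  Fin.ofNat 2 (Nat.digits 2 n).sum

/-- The length-`n` block `x i, x (i+1), …, x (i+n-1)` of the infinite word `x`. -/
def wordBlock {α : Type*} (x : ℕ → α) (i n : ℕ) : List α :=
  (List.range n).map fun j => x (i + j)

/-- The set of length-`n` factors of the infinite word `x`. -/
def wordFactors {α : Type*} (x : ℕ → α) (n : ℕ) : Set (List α) :=
  Set.range fun i => wordBlock x i n

/-- The length-`n` factors of `x` up to cyclic shift: `Cycle α` is the type of finite words over
`α` modulo the relation `List.IsRotated` of being cyclic shifts of each other. -/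
def cyclicFactors {α : Type*} (x : ℕ → α) (n : ℕ) : Set (Cycle α) :=
  (fun w : List α => (w : Cycle α)) '' wordFactors x n

/-- Over a finite alphabet there are finitely many factors of each length up to cyclic shift,
so that their `Set.ncard` is their actual number. -/
theorem cyclicFactors_finite {α : Type*} [Finite α] (x : ℕ → α) (n : ℕ) :
    (cyclicFactors x n).Finite := by
  refine Set.Finite.image _ ((List.finite_length_eq α n).subset ?_)
  rintro _ ⟨i, rfl⟩
  simp [wordBlock]

/-- The cyclic complexity of an infinite word `x` over a finite alphabet: the number of length-`n`
factors of `x`, where factors that agree up to cyclic shift are counted only once. -/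
noncomputable def cyclicComplexity {α : Type*} [Finite α] (x : ℕ → α) (n : ℕ) : ℕ :=
  (cyclicFactors x n).ncard

/-!
Let `μ` be the Thue–Morse morphism and let `D n` count the factors of length `n + 1` whose first and
last letters differ. A factor of length `2 * n` starting at an even position is `μ u` for a factor
`u` of length `n`. If it starts at an odd position, its cyclic shift by one letter is again such a
`μ u`, unless the corresponding factor of length `n + 1` has different end letters; the exceptions
give new cyclic words, which are pairwise distinct since `t` contains no cube of a letter. Hence
`c (2 * n) = c n + D n` for `4 ≤ n`.

Cyclic words of odd length `2 * n + 1` are represented, essentially uniquely, by pairs `(v, b)` with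
`b` the letter added to `μ v`. Counting these pairs gives `c (2 * n + 1) ≥ D (2 * n + 1)` up to a
bounded error governed by the right special factors of `t`. The recurrence `D (2 * n) = 2 * D n`
therefore propagates `c n ≥ D n - 16` from odd to even lengths. Finally `3 * D n ≥ 4 * n`, with
equality along `n = 6 * 2 ^ j`, where `c` and `D` differ by a constant.
-/

/-! ### Blocks and factors of an infinite word -/

section Blocks

variable {α : Type*} (x : ℕ → α)

theorem length_wordBlock (i n : ℕ) : (wordBlock x i n).length = n := by
  simp [wordBlock]

theorem wordBlock_add (i m n : ℕ) :
    wordBlock x i (m + n) = wordBlock x i m ++ wordBlock x (i + m) n := by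
  simp only [wordBlock, List.range_add, List.map_append, List.map_map, Function.comp_def,
    Nat.add_assoc]

theorem wordBlock_one (i : ℕ) : wordBlock x i 1 = [x i] := rfl

theorem wordBlock_succ (i n : ℕ) : wordBlock x i (n + 1) = x i :: wordBlock x (i + 1) n := by
  rw [Nat.add_comm n 1, wordBlock_add, wordBlock_one, List.singleton_append]

theorem wordBlock_succ' (i n : ℕ) : wordBlock x i (n + 1) = wordBlock x i n ++ [x (i + n)] := by
  rw [wordBlock_add, wordBlock_one]

theorem tail_wordBlock (i n : ℕ) : (wordBlock x i (n + 1)).tail = wordBlock x (i + 1) n := by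
  rw [wordBlock_succ, List.tail_cons]

theorem dropLast_wordBlock (i n : ℕ) : (wordBlock x i (n + 1)).dropLast = wordBlock x i n := by
  rw [wordBlock_succ', List.dropLast_concat]

theorem wordFactors_finite [Finite α] (n : ℕ) : (wordFactors x n).Finite := by
  refine (List.finite_length_eq α n).subset ?_
  rintro _ ⟨i, rfl⟩
  exact length_wordBlock x i n

/-- The word `w` occurs in the infinite word `x`; unlike in `wordFactors`, the length is not
prescribed. -/
def IsFactor (w : List α) : Prop := ∃ i, wordBlock x i w.length = w

variable {x}

theorem wordBlock_isRotated_succ {i n : ℕ} (h : x (i + n) = x i) :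
    wordBlock x i n ~r wordBlock x (i + 1) n := by
  cases n with
  | zero => exact List.IsRotated.refl []
  | succ n =>
    rw [wordBlock_succ, wordBlock_succ', show i + 1 + n = i + (n + 1) by omega, h]
    exact (List.isRotated_concat _ _).symm

theorem isFactor_wordBlock (i n : ℕ) : IsFactor x (wordBlock x i n) :=
  ⟨i, by rw [length_wordBlock]⟩

theorem mem_wordFactors_iff {n : ℕ} {w : List α} :
    w ∈ wordFactors x n ↔ IsFactor x w ∧ w.length = n := by
  constructor
  · rintro ⟨i, rfl⟩
    exact ⟨isFactor_wordBlock i n, length_wordBlock x i n⟩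
  · rintro ⟨h, rfl⟩
    exact h

theorem IsFactor.of_infix {u w : List α} (hu : IsFactor x u) (h : w <:+: u) : IsFactor x w := by
  obtain ⟨p, s, rfl⟩ := h
  obtain ⟨i, hi⟩ := hu
  simp only [List.length_append, wordBlock_add] at hi
  have hpw := List.append_inj_left' hi (by simp only [length_wordBlock])
  exact ⟨i + p.length, List.append_inj_right hpw (by simp only [length_wordBlock])⟩

theorem IsFactor.of_cons {a : α} {w : List α} (h : IsFactor x (a :: w)) : IsFactor x w :=
  h.of_infix (List.suffix_cons a w).isInfix

theorem IsFactor.of_append_left {w s : List α} (h : IsFactor x (w ++ s)) : IsFactor x w :=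
  h.of_infix (List.prefix_append w s).isInfix

end Blocks

/-! ### The Thue–Morse morphism -/

theorem fin_two_add_one_add_one (a : Fin 2) : a + 1 + 1 = a := by
  revert a; decide

theorem fin_two_add_one_ne (a : Fin 2) : a + 1 ≠ a := by
  revert a; decide

theorem fin_two_ne_iff {a b : Fin 2} : a ≠ b ↔ a = b + 1 := by
  revert a b; decide

/-- The Thue–Morse morphism `0 ↦ 01`, `1 ↦ 10`. -/
def thueMap (w : List (Fin 2)) : List (Fin 2) := w.flatMap fun a => [a, a + 1]

section ThueMap

variable {a b : Fin 2} {l₁ l₂ r u v w : List (Fin 2)}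

@[simp] theorem thueMap_nil : thueMap [] = [] := rfl

@[simp] theorem thueMap_cons (a : Fin 2) (w : List (Fin 2)) :
    thueMap (a :: w) = a :: (a + 1) :: thueMap w := rfl

@[simp] theorem thueMap_append (v w : List (Fin 2)) :
    thueMap (v ++ w) = thueMap v ++ thueMap w := List.flatMap_append

@[simp] theorem length_thueMap (w : List (Fin 2)) : (thueMap w).length = 2 * w.length := by
  induction w with
  | nil => rfl
  | cons a w ih => simp only [thueMap_cons, List.length_cons, ih]; ring

theorem count_thueMap (w : List (Fin 2)) (b : Fin 2) : (thueMap w).count b = w.length := by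
  induction w with
  | nil => rfl
  | cons a w ih =>
    have hab : ∀ a b : Fin 2, [a, a + 1].count b = 1 := by decide
    rw [thueMap_cons, ← List.singleton_append, ← List.singleton_append (l := thueMap w),
      ← List.append_assoc, List.singleton_append, List.count_append, hab, ih, List.length_cons,
      Nat.add_comm]

theorem thueMap_injective : Function.Injective thueMap := by
  intro v w h
  induction v generalizing w with
  | nil =>
    cases w with
    | nil => rfl
    | cons b w => simp at h
  | cons a v ih =>
    cases w with
    | nil => simp at h
    | cons b w =>
      simp only [thueMap_cons, List.cons.injEq] at h
      rw [h.1, ih h.2.2]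

theorem thueMap_append_eq_append (h : thueMap v ++ r = l₁ ++ l₂) (heven : Even l₁.length)
    (hle : l₁.length ≤ 2 * v.length) :
    ∃ v₁ v₂, v = v₁ ++ v₂ ∧ l₁ = thueMap v₁ ∧ l₂ = thueMap v₂ ++ r := by
  obtain ⟨k, hk⟩ := heven
  refine ⟨v.take k, v.drop k, (List.take_append_drop k v).symm, ?_⟩
  rw [← List.take_append_drop k v, thueMap_append, List.append_assoc] at h
  have hlen : (thueMap (v.take k)).length = l₁.length := by
    rw [length_thueMap, List.length_take]; omega
  exact ⟨(List.append_inj_left h hlen).symm, (List.append_inj_right h hlen).symm⟩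

theorem thueMap_eq_append (h : thueMap u = l₁ ++ l₂) :
    (∃ u₁ u₂, u = u₁ ++ u₂ ∧ l₁ = thueMap u₁ ∧ l₂ = thueMap u₂) ∨
      ∃ u₁ c u₂, u = u₁ ++ c :: u₂ ∧ l₁ = thueMap u₁ ++ [c] ∧ l₂ = (c + 1) :: thueMap u₂ := by
  have hlen : 2 * u.length = l₁.length + l₂.length := by
    rw [← length_thueMap, h, List.length_append]
  rcases Nat.even_or_odd l₁.length with heven | hodd
  · left
    simpa using thueMap_append_eq_append (r := []) (by simpa using h) heven (by omega)
  · right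
    obtain ⟨l, c, rfl⟩ := List.eq_nil_or_concat' l₁ |>.resolve_left (by rintro rfl; simp at hodd)
    simp only [List.length_append, List.length_singleton] at hodd hlen
    obtain ⟨u₁, u₂, rfl, rfl, hr⟩ := thueMap_append_eq_append (l₁ := l) (l₂ := c :: l₂) (r := [])
      (by simpa using h) (by simpa [Nat.odd_add_one] using hodd) (by omega)
    cases u₂ with
    | nil => simp at hr
    | cons d u₂ =>
      simp only [thueMap_cons, List.append_nil, List.cons.injEq] at hr
      obtain ⟨rfl, rfl⟩ := hr
      exact ⟨u₁, c, u₂, rfl, rfl, rfl⟩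

-- Reading the identity from left to right alternately determines letters of `w` and `v`.
theorem cons_thueMap_eq_thueMap_concat (h : a :: thueMap v = thueMap w ++ [b]) :
    b = a ∧ w = List.replicate v.length a ∧ v = List.replicate v.length (a + 1) := by
  induction v generalizing a w with
  | nil =>
    cases w with
    | nil => simpa using h.symm
    | cons c w => simp at h
  | cons c v ih =>
    cases w with
    | nil => simp at h
    | cons d w =>
      simp only [thueMap_cons, List.cons_append, List.cons.injEq] at h
      obtain ⟨rfl, rfl, h⟩ := h
      rw [fin_two_add_one_add_one] at h
      obtain ⟨rfl, hw, hv⟩ := ih h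
      exact ⟨rfl, congrArg (b :: ·) hw, congrArg ((b + 1) :: ·) hv⟩

theorem eq_replicate_of_cons_thueMap_concat (h : a :: (thueMap v ++ [b]) = thueMap w) :
    b = a + 1 ∧ v = List.replicate v.length (a + 1) := by
  obtain rfl | ⟨w, d, rfl⟩ := List.eq_nil_or_concat' w
  · simp at h
  · rw [thueMap_append, thueMap_cons, thueMap_nil, ← List.cons_append,
      ← List.singleton_append (l := [d + 1]), ← List.append_assoc] at h
    obtain ⟨h, hb⟩ := List.append_inj' h rfl
    obtain ⟨rfl, -, hv⟩ := cons_thueMap_eq_thueMap_concat h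
    exact ⟨by simpa using hb, hv⟩

end ThueMap

/-! ### Factors of the Thue–Morse word -/

theorem thueMorse_two_mul (n : ℕ) : thueMorse (2 * n) = thueMorse n := by
  rcases Nat.eq_zero_or_pos n with rfl | hn
  · rfl
  · rw [thueMorse, Nat.digits_def' one_lt_two (Nat.mul_pos two_pos hn), Nat.mul_mod_right,
      Nat.mul_div_cancel_left n two_pos, List.sum_cons, Nat.zero_add, thueMorse]

theorem thueMorse_two_mul_add_one (n : ℕ) : thueMorse (2 * n + 1) = thueMorse n + 1 := by
  rw [thueMorse, Nat.digits_def' one_lt_two (by positivity), Nat.mul_add_mod,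
    Nat.mul_add_div two_pos, List.sum_cons, thueMorse]
  ext
  simp [Fin.ofNat, Fin.val_add, Nat.add_comm]

theorem thueMap_wordBlock (i n : ℕ) :
    thueMap (wordBlock thueMorse i n) = wordBlock thueMorse (2 * i) (2 * n) := by
  induction n generalizing i with
  | zero => rfl
  | succ n ih =>
    rw [wordBlock_succ, thueMap_cons, ih, show 2 * (n + 1) = 2 * n + 1 + 1 by ring, wordBlock_succ,
      wordBlock_succ, thueMorse_two_mul, thueMorse_two_mul_add_one]
    rfl

theorem dropLast_thueMap_wordBlock (i n : ℕ) :
    (thueMap (wordBlock thueMorse i (n + 1))).dropLast =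
      wordBlock thueMorse (2 * i) (2 * n + 1) := by
  rw [thueMap_wordBlock, show 2 * (n + 1) = 2 * n + 1 + 1 by ring, dropLast_wordBlock]

theorem tail_thueMap_wordBlock (i n : ℕ) :
    (thueMap (wordBlock thueMorse i (n + 1))).tail =
      wordBlock thueMorse (2 * i + 1) (2 * n + 1) := by
  rw [thueMap_wordBlock, show 2 * (n + 1) = 2 * n + 1 + 1 by ring, tail_wordBlock]

theorem tail_dropLast_thueMap_wordBlock (i n : ℕ) :
    (thueMap (wordBlock thueMorse i (n + 1))).tail.dropLast =
      wordBlock thueMorse (2 * i + 1) (2 * n) := by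
  rw [tail_thueMap_wordBlock, dropLast_wordBlock]

theorem IsFactor.thueMap {w : List (Fin 2)} (h : IsFactor thueMorse w) :
    IsFactor thueMorse (thueMap w) := by
  obtain ⟨i, hi⟩ := h
  rw [← hi, thueMap_wordBlock]
  exact isFactor_wordBlock _ _

theorem thueMorse_no_cube (i : ℕ) :
    ¬ (thueMorse i = thueMorse (i + 1) ∧ thueMorse (i + 1) = thueMorse (i + 2)) := by
  rintro ⟨h₁, h₂⟩
  obtain ⟨j, rfl | rfl⟩ := Nat.even_or_odd' i
  · rw [thueMorse_two_mul, thueMorse_two_mul_add_one] at h₁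
    exact fin_two_add_one_ne _ h₁.symm
  · rw [show 2 * j + 1 + 1 = 2 * (j + 1) by ring, show 2 * j + 1 + 2 = 2 * (j + 1) + 1 by ring,
      thueMorse_two_mul, thueMorse_two_mul_add_one] at h₂
    exact fin_two_add_one_ne _ h₂.symm

theorem le_two_of_isFactor_replicate {k : ℕ} {a : Fin 2}
    (h : IsFactor thueMorse (List.replicate k a)) : k ≤ 2 := by
  by_contra! hk
  have hcube : IsFactor thueMorse (List.replicate 3 a) := h.of_infix <| by
    rw [← Nat.add_sub_cancel' hk, List.replicate_add]
    exact (List.prefix_append _ _).isInfix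
  obtain ⟨i, hi⟩ := hcube
  have hletters : [thueMorse i, thueMorse (i + 1), thueMorse (i + 2)] = [a, a, a] := hi
  simp only [List.cons.injEq] at hletters
  obtain ⟨h₀, h₁, h₂, -⟩ := hletters
  exact thueMorse_no_cube i ⟨h₀.trans h₁.symm, h₁.trans h₂.symm⟩

theorem isFactor_triple {a b c : Fin 2} (h : ¬ (a = b ∧ b = c)) :
    IsFactor thueMorse [a, b, c] := by
  have hfirst : ∀ a b c : Fin 2, ¬ (a = b ∧ b = c) →
      ∃ i : Fin 6, wordBlock thueMorse i 3 = [a, b, c] := by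
    decide
  obtain ⟨i, hi⟩ := hfirst a b c h
  exact ⟨i, hi⟩

/-! ### Factors with prescribed difference between the end letters -/

/-- The factors `a ⋯ (a + δ)` of length `n + 1` of the Thue–Morse word: those whose last letter
exceeds the first by `δ`. They are defined through positions, so that `t (i + n) = t i + δ` can be
analysed according to the parity of `i`. -/
def gapFactors (δ : Fin 2) (n : ℕ) : Set (List (Fin 2)) :=
  (fun i => wordBlock thueMorse i (n + 1)) '' {i | thueMorse (i + n) = thueMorse i + δ}

/-- The number of factors in `gapFactors δ n`. -/
noncomputable def gapCount (δ : Fin 2) (n : ℕ) : ℕ := (gapFactors δ n).ncard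

section GapFactors

variable {δ : Fin 2} {n : ℕ} {w : List (Fin 2)}

theorem gapFactors_subset_wordFactors (δ : Fin 2) (n : ℕ) :
    gapFactors δ n ⊆ wordFactors thueMorse (n + 1) := by
  rintro _ ⟨i, -, rfl⟩
  exact ⟨i, rfl⟩

theorem gapFactors_finite (δ : Fin 2) (n : ℕ) : (gapFactors δ n).Finite :=
  (wordFactors_finite thueMorse (n + 1)).subset (gapFactors_subset_wordFactors δ n)

theorem isFactor_of_mem_gapFactors (h : w ∈ gapFactors δ n) : IsFactor thueMorse w :=
  (mem_wordFactors_iff.1 (gapFactors_subset_wordFactors δ n h)).1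

theorem length_of_mem_gapFactors (h : w ∈ gapFactors δ n) : w.length = n + 1 :=
  (mem_wordFactors_iff.1 (gapFactors_subset_wordFactors δ n h)).2

theorem mem_gapFactors_succ :
    w ∈ gapFactors δ (n + 1) ↔
      ∃ a v, v.length = n ∧ w = a :: (v ++ [a + δ]) ∧ IsFactor thueMorse w := by
  have hblock (i : ℕ) : wordBlock thueMorse i (n + 1 + 1) =
      thueMorse i :: (wordBlock thueMorse (i + 1) n ++ [thueMorse (i + (n + 1))]) := by
    rw [wordBlock_succ', wordBlock_succ, List.cons_append]
  constructor
  · rintro ⟨i, hi : thueMorse (i + (n + 1)) = thueMorse i + δ, rfl⟩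
    refine ⟨thueMorse i, wordBlock thueMorse (i + 1) n, length_wordBlock _ _ _, ?_,
      isFactor_wordBlock _ _⟩
    dsimp only
    rw [hblock, hi]
  · rintro ⟨a, v, rfl, rfl, i, hi⟩
    rw [List.length_cons, List.length_append, List.length_singleton] at hi
    have hi' := hi
    rw [hblock, List.cons.injEq, List.append_singleton_inj] at hi'
    exact ⟨i, hi'.2.2.trans (congrArg (· + δ) hi'.1.symm), hi⟩

theorem ncard_wordFactors_eq_gapCount_add (n : ℕ) :
    (wordFactors thueMorse (n + 1)).ncard = gapCount 0 n + gapCount 1 n := by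
  rw [gapCount, gapCount, ← Set.ncard_union_eq _ (gapFactors_finite 0 n) (gapFactors_finite 1 n)]
  · congr 1
    refine Set.Subset.antisymm ?_ (Set.union_subset (gapFactors_subset_wordFactors 0 n)
      (gapFactors_subset_wordFactors 1 n))
    rintro _ ⟨i, rfl⟩
    by_cases h : thueMorse (i + n) = thueMorse i
    · exact Or.inl ⟨i, by simpa using h, rfl⟩
    · exact Or.inr ⟨i, fin_two_ne_iff.1 h, rfl⟩
  · rw [Set.disjoint_left]
    rintro _ ⟨i, hi : thueMorse (i + n) = thueMorse i + 0, rfl⟩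
      ⟨j, hj : thueMorse (j + n) = thueMorse j + 1, hij⟩
    dsimp only at hij
    have hhead : thueMorse j = thueMorse i := by
      rw [wordBlock_succ, wordBlock_succ, List.cons.injEq] at hij
      exact hij.1
    have hlast : thueMorse (j + n) = thueMorse (i + n) := by
      rw [wordBlock_succ', wordBlock_succ', List.append_singleton_inj] at hij
      exact hij.2
    rw [hlast, hi, hhead, add_zero] at hj
    exact fin_two_add_one_ne _ hj.symm

theorem gapFactors_two_mul (δ : Fin 2) (n : ℕ) :
    gapFactors δ (2 * n) = (fun w => (thueMap w).dropLast) '' gapFactors δ n ∪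
      (fun w => (thueMap w).tail) '' gapFactors δ n := by
  have heven (j : ℕ) : thueMorse (2 * j + 2 * n) = thueMorse (2 * j) + δ ↔
      thueMorse (j + n) = thueMorse j + δ := by
    rw [← Nat.mul_add, thueMorse_two_mul, thueMorse_two_mul]
  have hodd (j : ℕ) : thueMorse (2 * j + 1 + 2 * n) = thueMorse (2 * j + 1) + δ ↔
      thueMorse (j + n) = thueMorse j + δ := by
    rw [show 2 * j + 1 + 2 * n = 2 * (j + n) + 1 by ring, thueMorse_two_mul_add_one,
      thueMorse_two_mul_add_one, add_right_comm, add_left_inj]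
  apply Set.Subset.antisymm
  · rintro _ ⟨i, hi, rfl⟩
    obtain ⟨j, rfl | rfl⟩ := Nat.even_or_odd' i
    · exact Or.inl ⟨_, ⟨j, (heven j).1 hi, rfl⟩, dropLast_thueMap_wordBlock j n⟩
    · exact Or.inr ⟨_, ⟨j, (hodd j).1 hi, rfl⟩, tail_thueMap_wordBlock j n⟩
  · rintro _ (⟨_, ⟨j, hj, rfl⟩, rfl⟩ | ⟨_, ⟨j, hj, rfl⟩, rfl⟩)
    · exact ⟨2 * j, (heven j).2 hj, (dropLast_thueMap_wordBlock j n).symm⟩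
    · exact ⟨2 * j + 1, (hodd j).2 hj, (tail_thueMap_wordBlock j n).symm⟩

theorem gapFactors_two_mul_add_one (δ : Fin 2) (n : ℕ) :
    gapFactors δ (2 * n + 1) = thueMap '' gapFactors (δ + 1) n ∪
      (fun w => (thueMap w).tail.dropLast) '' gapFactors (δ + 1) (n + 1) := by
  have heven (j : ℕ) : thueMorse (2 * j + (2 * n + 1)) = thueMorse (2 * j) + δ ↔
      thueMorse (j + n) = thueMorse j + (δ + 1) := by
    rw [← Nat.add_assoc, ← Nat.mul_add, thueMorse_two_mul_add_one, thueMorse_two_mul,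
      ← add_left_inj 1, fin_two_add_one_add_one, add_assoc]
  have hodd (j : ℕ) : thueMorse (2 * j + 1 + (2 * n + 1)) = thueMorse (2 * j + 1) + δ ↔
      thueMorse (j + (n + 1)) = thueMorse j + (δ + 1) := by
    rw [show 2 * j + 1 + (2 * n + 1) = 2 * (j + (n + 1)) by ring, thueMorse_two_mul,
      thueMorse_two_mul_add_one, add_right_comm, add_assoc]
  apply Set.Subset.antisymm
  · rintro _ ⟨i, hi, rfl⟩
    obtain ⟨j, rfl | rfl⟩ := Nat.even_or_odd' i
    · exact Or.inl ⟨_, ⟨j, (heven j).1 hi, rfl⟩, thueMap_wordBlock j (n + 1)⟩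
    · exact Or.inr ⟨_, ⟨j, (hodd j).1 hi, rfl⟩, tail_dropLast_thueMap_wordBlock j (n + 1)⟩
  · rintro _ (⟨_, ⟨j, hj, rfl⟩, rfl⟩ | ⟨_, ⟨j, hj, rfl⟩, rfl⟩)
    · exact ⟨2 * j, (heven j).2 hj, (thueMap_wordBlock j (n + 1)).symm⟩
    · exact ⟨2 * j + 1, (hodd j).2 hj, (tail_dropLast_thueMap_wordBlock j (n + 1)).symm⟩

end GapFactors

theorem dropLast_thueMap_concat (v : List (Fin 2)) (a : Fin 2) :
    (thueMap (v ++ [a])).dropLast = thueMap v ++ [a] := by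
  rw [thueMap_append, thueMap_cons, thueMap_nil, List.dropLast_append_of_ne_nil (by simp)]
  rfl

theorem tail_thueMap_cons (a : Fin 2) (v : List (Fin 2)) :
    (thueMap (a :: v)).tail = (a + 1) :: thueMap v := rfl

theorem tail_dropLast_thueMap (a : Fin 2) (v : List (Fin 2)) (b : Fin 2) :
    (thueMap (a :: (v ++ [b]))).tail.dropLast = (a + 1) :: (thueMap v ++ [b]) := by
  rw [tail_thueMap_cons, List.dropLast_cons_of_ne_nil (by simp), dropLast_thueMap_concat]

section GapCount

variable {δ : Fin 2} {n : ℕ}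

theorem injOn_dropLast_thueMap : Set.InjOn (fun w => (thueMap w).dropLast) {w | w ≠ []} := by
  intro u hu w hw h
  obtain ⟨u, a, rfl⟩ := (List.eq_nil_or_concat' u).resolve_left hu
  obtain ⟨w, b, rfl⟩ := (List.eq_nil_or_concat' w).resolve_left hw
  simp only [dropLast_thueMap_concat, List.append_singleton_inj] at h
  rw [thueMap_injective h.1, h.2]

theorem injOn_tail_thueMap : Set.InjOn (fun w => (thueMap w).tail) {w | w ≠ []} := by
  intro u hu w hw h
  obtain ⟨a, u, rfl⟩ := List.exists_cons_of_ne_nil hu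
  obtain ⟨b, w, rfl⟩ := List.exists_cons_of_ne_nil hw
  simp only [tail_thueMap_cons, List.cons.injEq, add_left_inj] at h
  rw [h.1, thueMap_injective h.2]

theorem gapFactors_subset_ne_nil : gapFactors δ n ⊆ {w | w ≠ []} := by
  intro w hw
  exact List.ne_nil_of_length_eq_add_one (length_of_mem_gapFactors hw)

theorem injOn_tail_dropLast_thueMap :
    Set.InjOn (fun w => (thueMap w).tail.dropLast) (gapFactors δ (n + 1)) := by
  intro u hu w hw h
  obtain ⟨a, v, -, rfl, -⟩ := mem_gapFactors_succ.1 hu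
  obtain ⟨b, v', -, rfl, -⟩ := mem_gapFactors_succ.1 hw
  simp only [tail_dropLast_thueMap, List.cons.injEq, add_left_inj, List.append_singleton_inj] at h
  rw [h.1, thueMap_injective h.2.1]

theorem dropLast_thueMap_ne_tail_thueMap {u w : List (Fin 2)} (hu : u ≠ [])
    (hw : IsFactor thueMorse w) (hlen : 3 ≤ w.length) :
    (thueMap u).dropLast ≠ (thueMap w).tail := by
  intro h
  obtain ⟨v, b, rfl⟩ := (List.eq_nil_or_concat' u).resolve_left hu
  obtain ⟨a, z, rfl⟩ := List.exists_cons_of_length_pos (by omega : 0 < w.length)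
  rw [dropLast_thueMap_concat, tail_thueMap_cons] at h
  obtain ⟨-, -, hz⟩ := cons_thueMap_eq_thueMap_concat h.symm
  rw [fin_two_add_one_add_one] at hz
  rw [hz, ← List.replicate_succ] at hw
  exact absurd (le_two_of_isFactor_replicate hw) (not_le.2 hlen)

theorem thueMap_ne_tail_dropLast_thueMap {u w : List (Fin 2)}
    (hw : w ∈ gapFactors δ (n + 1)) (hn : 1 ≤ n) :
    thueMap u ≠ (thueMap w).tail.dropLast := by
  intro h
  obtain ⟨a, v, rfl, rfl, hfac⟩ := mem_gapFactors_succ.1 hw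
  rw [tail_dropLast_thueMap] at h
  obtain ⟨hδ, hv⟩ := eq_replicate_of_cons_thueMap_concat h.symm
  rw [fin_two_add_one_add_one] at hδ hv
  rw [hδ, hv, ← List.replicate_succ', ← List.replicate_succ] at hfac
  have := le_two_of_isFactor_replicate hfac
  omega

theorem ncard_image_union_image {α β γ : Type*} {f : α → γ} {g : β → γ} {A : Set α} {B : Set β}
    (hA : A.Finite) (hB : B.Finite) (hf : A.InjOn f) (hg : B.InjOn g)
    (h : ∀ a ∈ A, ∀ b ∈ B, f a ≠ g b) : (f '' A ∪ g '' B).ncard = A.ncard + B.ncard := by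
  have hdisj : Disjoint (f '' A) (g '' B) := by
    rw [Set.disjoint_left]
    rintro _ ⟨a, ha, rfl⟩ ⟨b, hb, hab⟩
    exact h a ha b hb hab.symm
  rw [Set.ncard_union_eq hdisj (hA.image f) (hB.image g), hf.ncard_image, hg.ncard_image]

theorem gapCount_two_mul (δ : Fin 2) (hn : 2 ≤ n) : gapCount δ (2 * n) = 2 * gapCount δ n := by
  rw [gapCount, gapFactors_two_mul, ncard_image_union_image (gapFactors_finite δ n)
    (gapFactors_finite δ n) (injOn_dropLast_thueMap.mono gapFactors_subset_ne_nil)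
    (injOn_tail_thueMap.mono gapFactors_subset_ne_nil), ← two_mul, gapCount]
  intro u hu w hw
  refine dropLast_thueMap_ne_tail_thueMap (gapFactors_subset_ne_nil hu)
    (isFactor_of_mem_gapFactors hw) ?_
  rw [length_of_mem_gapFactors hw]
  omega

theorem gapCount_two_mul_add_one (δ : Fin 2) (hn : 1 ≤ n) :
    gapCount δ (2 * n + 1) = gapCount (δ + 1) n + gapCount (δ + 1) (n + 1) := by
  rw [gapCount, gapFactors_two_mul_add_one, ncard_image_union_image (gapFactors_finite _ n)
    (gapFactors_finite _ (n + 1)) thueMap_injective.injOn injOn_tail_dropLast_thueMap, gapCount,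
    gapCount]
  exact fun u _ w hw => thueMap_ne_tail_dropLast_thueMap hw hn

theorem gapCount_one (δ : Fin 2) : gapCount δ 1 = 2 := by
  have hrange : gapFactors δ 1 = Set.range fun a : Fin 2 => [a, a + δ] := by
    ext w
    rw [mem_gapFactors_succ]
    constructor
    · rintro ⟨a, v, hv, rfl, -⟩
      obtain rfl := List.length_eq_zero_iff.1 hv
      exact ⟨a, rfl⟩
    · rintro ⟨a, rfl⟩
      have hfac : IsFactor thueMorse [a, a + δ, a + δ + 1] := isFactor_triple fun h =>
        fin_two_add_one_ne (a + δ) h.2.symm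
      exact ⟨a, [], rfl, rfl, hfac.of_infix (List.prefix_append [a, a + δ] _).isInfix⟩
  rw [gapCount, hrange, Set.ncard_range_of_injective, Nat.card_fin]
  exact fun a b h => (List.cons.inj h).1

theorem gapCount_zero_two : gapCount 0 2 = 2 := by
  have hrange : gapFactors 0 2 = Set.range fun a : Fin 2 => [a, a + 1, a] := by
    ext w
    rw [mem_gapFactors_succ]
    constructor
    · rintro ⟨a, v, hv, rfl, hfac⟩
      obtain ⟨b, rfl⟩ := List.length_eq_one_iff.1 hv
      rw [add_zero] at hfac ⊢
      have hba : b ≠ a := by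
        rintro rfl
        exact absurd (le_two_of_isFactor_replicate (k := 3) hfac) (by norm_num)
      exact ⟨a, by rw [fin_two_ne_iff.1 hba]; rfl⟩
    · rintro ⟨a, rfl⟩
      exact ⟨a, [a + 1], rfl, by rw [add_zero]; rfl,
        isFactor_triple fun h => fin_two_add_one_ne a h.2⟩
  rw [gapCount, hrange, Set.ncard_range_of_injective, Nat.card_fin]
  exact fun a b h => (List.cons.inj h).1

theorem gapCount_one_two : gapCount 1 2 = 4 := by
  have hrange : gapFactors 1 2 = Set.range fun p : Fin 2 × Fin 2 => [p.1, p.2, p.1 + 1] := by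
    ext w
    rw [mem_gapFactors_succ]
    constructor
    · rintro ⟨a, v, hv, rfl, -⟩
      obtain ⟨b, rfl⟩ := List.length_eq_one_iff.1 hv
      exact ⟨(a, b), rfl⟩
    · rintro ⟨⟨a, b⟩, rfl⟩
      exact ⟨a, [b], rfl, rfl, isFactor_triple fun h =>
        fin_two_add_one_ne a (h.1.trans h.2).symm⟩
  rw [gapCount, hrange, Set.ncard_range_of_injective, Nat.card_prod, Nat.card_fin]
  rintro ⟨a, b⟩ ⟨c, d⟩ h
  simp only [List.cons.injEq] at h
  rw [h.1, h.2.1]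

end GapCount

section GapCountBounds

variable {n : ℕ}

theorem gapCount_zero_two_mul_add_one (hn : 1 ≤ n) :
    gapCount 0 (2 * n + 1) = gapCount 1 n + gapCount 1 (n + 1) :=
  gapCount_two_mul_add_one 0 hn

theorem gapCount_one_two_mul_add_one (hn : 1 ≤ n) :
    gapCount 1 (2 * n + 1) = gapCount 0 n + gapCount 0 (n + 1) :=
  gapCount_two_mul_add_one 1 hn

theorem gapCount_two_mul_add_two (δ : Fin 2) (hn : 1 ≤ n) :
    gapCount δ (2 * n + 1 + 1) = 2 * gapCount δ (n + 1) := by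
  rw [← gapCount_two_mul δ (Nat.succ_le_succ hn), Nat.mul_succ]

theorem gapCount_zero_three : gapCount 0 3 = 6 := by
  rw [show 3 = 2 * 1 + 1 by rfl, gapCount_zero_two_mul_add_one le_rfl, gapCount_one,
    gapCount_one_two]

theorem gapCount_one_three : gapCount 1 3 = 4 := by
  rw [show 3 = 2 * 1 + 1 by rfl, gapCount_one_two_mul_add_one le_rfl, gapCount_one,
    gapCount_zero_two]

theorem halving_induction {p : ∀ n : ℕ, 1 ≤ n → Prop} (one : p 1 le_rfl) (two : p 2 one_le_two)
    (even : ∀ m (hm : 2 ≤ m), p m (by omega) → p (m + 1) (by omega) → p (2 * m) (by omega))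
    (odd : ∀ m (hm : 1 ≤ m), p m hm → p (m + 1) (by omega) → p (2 * m + 1) (by omega))
    (n : ℕ) (hn : 1 ≤ n) : p n hn := by
  induction n using Nat.strong_induction_on with
  | _ n ih =>
    obtain rfl | rfl | hlt : n = 1 ∨ n = 2 ∨ 3 ≤ n := by omega
    · exact one
    · exact two
    · obtain ⟨m, rfl | rfl⟩ := Nat.even_or_odd' n
      · exact even m (by omega) (ih m (by omega) (by omega)) (ih (m + 1) (by omega) (by omega))
      · exact odd m (by omega) (ih m (by omega) (by omega)) (ih (m + 1) (by omega) (by omega))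

-- The last conjunct, which is the third one at `2 * n + 1`, makes the induction go through.
theorem gapCount_lower_bounds (hn : 1 ≤ n) :
    n ≤ gapCount 0 n ∧ 3 * n ≤ gapCount 0 n + gapCount 1 n ∧ 4 * n ≤ 3 * gapCount 1 n ∧
      4 * (2 * n + 1) ≤ 3 * (gapCount 0 n + gapCount 0 (n + 1)) := by
  induction n, hn using halving_induction with
  | one => norm_num [gapCount_one, gapCount_zero_two]
  | two => norm_num [gapCount_zero_two, gapCount_one_two, gapCount_zero_three]
  | even m hm ih ih' =>
    have hE := gapCount_two_mul 0 hm
    have hD := gapCount_two_mul 1 hm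
    have hE' := gapCount_zero_two_mul_add_one (n := m) (by omega)
    omega
  | odd m hm ih ih' =>
    have hE := gapCount_zero_two_mul_add_one hm
    have hD := gapCount_one_two_mul_add_one hm
    have hE' := gapCount_two_mul_add_two 0 hm
    omega

theorem gapCount_one_six_mul_two_pow (j : ℕ) : gapCount 1 (6 * 2 ^ j) = 8 * 2 ^ j := by
  induction j with
  | zero =>
    rw [show 6 * 2 ^ 0 = 2 * 3 by rfl, gapCount_two_mul 1 (by norm_num), gapCount_one_three]
    rfl
  | succ j ih =>
    rw [show 6 * 2 ^ (j + 1) = 2 * (6 * 2 ^ j) by ring,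
      gapCount_two_mul 1 (by have := Nat.one_le_two_pow (n := j); omega), ih]
    ring

theorem gapCount_add_succ_le (hn : 1 ≤ n) :
    gapCount 0 (n + 1) + gapCount 1 (n + 1) ≤ gapCount 0 n + gapCount 1 n + 4 := by
  induction n, hn using halving_induction with
  | one => norm_num [gapCount_one, gapCount_zero_two, gapCount_one_two]
  | two => norm_num [gapCount_zero_two, gapCount_one_two, gapCount_zero_three, gapCount_one_three]
  | even m hm ih _ =>
    have hE := gapCount_two_mul 0 hm
    have hD := gapCount_two_mul 1 hm
    have hE' := gapCount_zero_two_mul_add_one (n := m) (by omega)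
    have hD' := gapCount_one_two_mul_add_one (n := m) (by omega)
    omega
  | odd m hm ih _ =>
    have hE := gapCount_zero_two_mul_add_one hm
    have hD := gapCount_one_two_mul_add_one hm
    have hE' := gapCount_two_mul_add_two 0 hm
    have hD' := gapCount_two_mul_add_two 1 hm
    omega

end GapCountBounds

/-! ### Right special factors -/

section RightSpecial

variable {x : ℕ → Fin 2} {n : ℕ}

/-- The right special factors of length `n` of a binary word `x`: the words both of whose
one-letter extensions to the right are factors of `x`. -/
def rightSpecialFactors (x : ℕ → Fin 2) (n : ℕ) : Set (List (Fin 2)) :=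
  {z | ∀ b, z ++ [b] ∈ wordFactors x (n + 1)}

theorem mem_wordFactors_of_concat {z : List (Fin 2)} {b : Fin 2}
    (h : z ++ [b] ∈ wordFactors x (n + 1)) : z ∈ wordFactors x n := by
  rw [mem_wordFactors_iff, List.length_append, List.length_singleton] at h
  exact mem_wordFactors_iff.2 ⟨h.1.of_append_left, Nat.add_right_cancel h.2⟩

theorem rightSpecialFactors_finite (x : ℕ → Fin 2) (n : ℕ) : (rightSpecialFactors x n).Finite :=
  (wordFactors_finite x n).subset fun _ h => mem_wordFactors_of_concat (h 0)

theorem ncard_wordFactors_succ (x : ℕ → Fin 2) (n : ℕ) :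
    (wordFactors x (n + 1)).ncard = (wordFactors x n).ncard + (rightSpecialFactors x n).ncard := by
  let A (b : Fin 2) : Set (List (Fin 2)) := {z | z ++ [b] ∈ wordFactors x (n + 1)}
  have hA (b : Fin 2) : (A b).Finite :=
    (wordFactors_finite x n).subset fun _ h => mem_wordFactors_of_concat h
  have hshort : wordFactors x n = A 0 ∪ A 1 := by
    refine Set.Subset.antisymm ?_
      (Set.union_subset (fun _ h => mem_wordFactors_of_concat h)
        fun _ h => mem_wordFactors_of_concat h)
    rintro _ ⟨i, rfl⟩
    have hi : wordBlock x i n ∈ A (x (i + n)) := ⟨i, wordBlock_succ' _ _ _⟩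
    generalize x (i + n) = b at hi
    fin_cases b
    exacts [Or.inl hi, Or.inr hi]
  have hlong : wordFactors x (n + 1) = (· ++ [0]) '' A 0 ∪ (· ++ [1]) '' A 1 := by
    refine Set.Subset.antisymm ?_ (Set.union_subset (Set.image_subset_iff.2 fun _ h => h)
      (Set.image_subset_iff.2 fun _ h => h))
    rintro w hw
    obtain ⟨z, b, rfl⟩ := (List.eq_nil_or_concat' w).resolve_left
      (List.ne_nil_of_length_eq_add_one (mem_wordFactors_iff.1 hw).2)
    fin_cases b
    exacts [Or.inl ⟨z, hw, rfl⟩, Or.inr ⟨z, hw, rfl⟩]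
  have hspecial : rightSpecialFactors x n = A 0 ∩ A 1 := Set.ext fun z => Fin.forall_fin_two
  rw [hlong, ncard_image_union_image (hA 0) (hA 1) (List.append_left_injective _).injOn
    (List.append_left_injective _).injOn (fun a _ b _ h => by simpa using List.append_inj' h rfl),
    hshort, hspecial, ← Set.ncard_union_add_ncard_inter _ _ (hA 0) (hA 1)]

theorem ncard_rightSpecialFactors_thueMorse_le (hn : 2 ≤ n) :
    (rightSpecialFactors thueMorse n).ncard ≤ 4 := by
  obtain ⟨m, rfl⟩ := Nat.exists_eq_add_of_le hn
  have hstep := gapCount_add_succ_le (n := 1 + m) (by omega)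
  have hsucc := ncard_wordFactors_succ thueMorse (1 + m + 1)
  rw [ncard_wordFactors_eq_gapCount_add, ncard_wordFactors_eq_gapCount_add] at hsucc
  rw [show 2 + m = 1 + m + 1 by ring]
  omega

end RightSpecial

/-! ### Factors of even length up to cyclic shift -/

theorem exists_append_of_isRotated {α : Type*} {l l' : List α} (h : l ~r l') :
    ∃ l₁ l₂, l = l₁ ++ l₂ ∧ l' = l₂ ++ l₁ := by
  obtain ⟨n, hn, rfl⟩ := List.isRotated_iff_mod.1 h
  exact ⟨l.take n, l.drop n, (List.take_append_drop n l).symm, List.rotate_eq_drop_append_take hn⟩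

section EvenLength

variable {b b' : Fin 2} {n : ℕ} {u u' v v' : List (Fin 2)}

theorem isRotated_thueMap (h : u ~r u') : thueMap u ~r thueMap u' := by
  obtain ⟨l₁, l₂, rfl, rfl⟩ := exists_append_of_isRotated h
  rw [thueMap_append, thueMap_append]
  exact List.isRotated_append

/-- The action of the Thue–Morse morphism on cyclic words. -/
def cycleThueMap : Cycle (Fin 2) → Cycle (Fin 2) :=
  Quotient.map thueMap fun _ _ => isRotated_thueMap

theorem isRotated_of_isRotated_thueMap (hu : IsFactor thueMorse u) (hlen : 3 ≤ u.length)
    (h : thueMap u ~r thueMap u') : u ~r u' := by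
  obtain ⟨l₁, l₂, h₁, h₂⟩ := exists_append_of_isRotated h
  rcases thueMap_eq_append h₁ with ⟨u₁, u₂, rfl, rfl, rfl⟩ | ⟨u₁, c, u₂, rfl, rfl, rfl⟩
  · rw [← thueMap_append] at h₂
    rw [thueMap_injective h₂]
    exact List.isRotated_append
  · have hconst : u₂ ++ u₁ = List.replicate (u₂ ++ u₁).length c := by
      rw [List.cons_append, ← List.append_assoc, ← thueMap_append] at h₂
      simpa only [fin_two_add_one_add_one] using
        (eq_replicate_of_cons_thueMap_concat h₂.symm).2
    obtain ⟨-, hu₂, hu₁⟩ := List.append_eq_replicate_iff.1 hconst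
    rw [hu₁, hu₂, ← List.replicate_succ, List.replicate_append_replicate] at hu
    have := le_two_of_isFactor_replicate hu
    rw [List.length_append, List.length_cons] at hlen
    omega

theorem injOn_cycleThueMap (hn : 3 ≤ n) : (cyclicFactors thueMorse n).InjOn cycleThueMap := by
  rintro _ ⟨u, hu, rfl⟩ _ ⟨u', -, rfl⟩ h
  obtain ⟨hfac, rfl⟩ := mem_wordFactors_iff.1 hu
  exact Cycle.coe_eq_coe.2 (isRotated_of_isRotated_thueMap hfac hn (Cycle.coe_eq_coe.1 h))

theorem not_isRotated_cons_thueMap_concat : ¬ thueMap u ~r b :: (thueMap v ++ [b]) := by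
  intro h
  have hcount := h.perm.count_eq b
  have hlen := h.perm.length_eq
  simp only [List.count_cons_self, List.count_append, count_thueMap, List.length_cons,
    List.length_append, List.length_nil, length_thueMap] at hcount hlen
  omega

theorem eq_replicate_append_replicate_of_cons_thueMap_concat {m₁ m₂ : List (Fin 2)}
    (hv : thueMap v = m₁ ++ m₂) (h : b' :: (thueMap v' ++ [b']) = m₂ ++ [b] ++ b :: m₁) :
    ∃ k l, v' = List.replicate k (b' + 1) ++ List.replicate l b' := by
  rcases thueMap_eq_append hv with ⟨v₁, v₂, -, rfl, rfl⟩ | ⟨v₁, c, v₂, -, rfl, rfl⟩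
  · obtain ⟨e, m, hm⟩ := List.exists_cons_of_ne_nil (l := thueMap v₂ ++ [b]) (by simp)
    rw [hm, List.cons_append, List.cons.injEq] at h
    obtain ⟨rfl, h⟩ := h
    have hm_len : m.length = 2 * v₂.length := by simpa using (congrArg List.length hm).symm
    have hlen := congrArg List.length h
    simp only [List.length_append, List.length_cons, List.length_nil, length_thueMap] at hlen
    obtain ⟨y₁, y₂, rfl, rfl, hy⟩ :=
      thueMap_append_eq_append h (hm_len ▸ even_two_mul _) (by omega)
    obtain ⟨rfl, -, hy₁⟩ := cons_thueMap_eq_thueMap_concat hm.symm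
    obtain ⟨-, hy₂, -⟩ := cons_thueMap_eq_thueMap_concat hy
    exact ⟨_, _, congrArg₂ _ hy₁ hy₂⟩
  · have hends : b' = c + 1 ∧ b' = c := by
      rw [List.cons_append, List.cons_append, List.cons.injEq, ← List.cons_append,
        ← List.append_assoc, List.append_singleton_inj] at h
      exact ⟨h.1, h.2.2⟩
    exact absurd (hends.1.symm.trans hends.2) (fin_two_add_one_ne c)

theorem eq_or_eq_replicate_of_isRotated_cons_thueMap_concat
    (h : b :: (thueMap v ++ [b]) ~r b' :: (thueMap v' ++ [b'])) :
    (b = b' ∧ v = v') ∨ ∃ k l, v' = List.replicate k (b' + 1) ++ List.replicate l b' := by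
  have heq (h : b :: (thueMap v ++ [b]) = b' :: (thueMap v' ++ [b'])) : b = b' ∧ v = v' := by
    rw [List.cons.injEq, List.append_singleton_inj] at h
    exact ⟨h.1, thueMap_injective h.2.1⟩
  obtain ⟨l₁, l₂, h₁, h₂⟩ := exists_append_of_isRotated h
  obtain rfl | ⟨m₂, d, rfl⟩ := List.eq_nil_or_concat' l₂
  · exact Or.inl (heq (by rw [h₁, h₂, List.append_nil, List.nil_append]))
  cases l₁ with
  | nil => exact Or.inl (heq (by rw [h₁, h₂, List.append_nil, List.nil_append]))
  | cons e m₁ =>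
    rw [List.cons_append, List.cons.injEq, ← List.append_assoc, List.append_singleton_inj] at h₁
    obtain ⟨rfl, hv, rfl⟩ := h₁
    exact Or.inr (eq_replicate_append_replicate_of_cons_thueMap_concat hv h₂)

theorem injOn_cycle_tail_dropLast_thueMap (hn : 4 ≤ n) :
    (gapFactors 1 n).InjOn fun w => ((thueMap w).tail.dropLast : Cycle (Fin 2)) := by
  obtain ⟨m, rfl⟩ := Nat.exists_eq_add_of_le' (by omega : 1 ≤ n)
  intro w hw w' hw' h
  obtain ⟨a, v, -, rfl, -⟩ := mem_gapFactors_succ.1 hw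
  obtain ⟨a', v', hlen, rfl, hfac⟩ := mem_gapFactors_succ.1 hw'
  simp only [tail_dropLast_thueMap, Cycle.coe_eq_coe] at h
  rcases eq_or_eq_replicate_of_isRotated_cons_thueMap_concat h with ⟨ha, rfl⟩ | ⟨k, l, rfl⟩
  · rw [add_left_inj] at ha
    rw [ha]
  · rw [fin_two_add_one_add_one, List.append_assoc, ← List.cons_append, ← List.replicate_succ,
      ← List.replicate_succ'] at hfac
    have hk := le_two_of_isFactor_replicate hfac.of_append_left
    have hl := le_two_of_isFactor_replicate (hfac.of_infix (List.suffix_append _ _).isInfix)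
    rw [List.length_append, List.length_replicate, List.length_replicate] at hlen
    omega

theorem cyclicFactors_two_mul (n : ℕ) :
    cyclicFactors thueMorse (2 * n) = cycleThueMap '' cyclicFactors thueMorse n ∪
      (fun w => ((thueMap w).tail.dropLast : Cycle (Fin 2))) '' gapFactors 1 n := by
  apply Set.Subset.antisymm
  · rintro _ ⟨_, ⟨i, rfl⟩, rfl⟩
    have hblock (j : ℕ) : (wordBlock thueMorse (2 * j) (2 * n) : Cycle (Fin 2)) ∈
        cycleThueMap '' cyclicFactors thueMorse n :=
      ⟨_, ⟨_, ⟨j, rfl⟩, rfl⟩, congrArg _ (thueMap_wordBlock j n)⟩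
    obtain ⟨j, rfl | rfl⟩ := Nat.even_or_odd' i
    · exact Or.inl (hblock j)
    · by_cases hj : thueMorse (j + n) = thueMorse j
      · left
        have hrot : wordBlock thueMorse (2 * j) (2 * n) ~r
            wordBlock thueMorse (2 * j + 1) (2 * n) := wordBlock_isRotated_succ <| by
          rw [← Nat.mul_add, thueMorse_two_mul, thueMorse_two_mul, hj]
        have hmem := hblock j
        rwa [Cycle.coe_eq_coe.2 hrot] at hmem
      · exact Or.inr ⟨_, ⟨j, fin_two_ne_iff.1 hj, rfl⟩,
          congrArg _ (tail_dropLast_thueMap_wordBlock j n)⟩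
  · rintro _ (⟨_, ⟨_, ⟨j, rfl⟩, rfl⟩, rfl⟩ | ⟨_, ⟨j, -, rfl⟩, rfl⟩)
    · exact ⟨_, ⟨2 * j, rfl⟩, congrArg _ (thueMap_wordBlock j n).symm⟩
    · exact ⟨_, ⟨2 * j + 1, rfl⟩, congrArg _ (tail_dropLast_thueMap_wordBlock j n).symm⟩

theorem cyclicComplexity_two_mul (hn : 4 ≤ n) :
    cyclicComplexity thueMorse (2 * n) = cyclicComplexity thueMorse n + gapCount 1 n := by
  rw [cyclicComplexity, cyclicFactors_two_mul, ncard_image_union_image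
    (cyclicFactors_finite thueMorse n) (gapFactors_finite 1 n) (injOn_cycleThueMap (by omega))
    (injOn_cycle_tail_dropLast_thueMap hn), cyclicComplexity, gapCount]
  rintro _ ⟨u, -, rfl⟩ w hw h
  obtain ⟨m, rfl⟩ := Nat.exists_eq_add_of_le' (by omega : 1 ≤ n)
  obtain ⟨a, v, -, rfl, -⟩ := mem_gapFactors_succ.1 hw
  rw [tail_dropLast_thueMap] at h
  exact not_isRotated_cons_thueMap_concat (Cycle.coe_eq_coe.1 h)

end EvenLength

/-! ### Factors of odd length up to cyclic shift -/

section OddLength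

variable {b b' : Fin 2} {i : ℕ} {l₁ l₂ v v' z : List (Fin 2)}

theorem exists_replicate_of_thueMap_concat_eq_append (h : thueMap v ++ [b] = l₁ ++ l₂)
    (h' : thueMap v' ++ [b'] = l₂ ++ l₁) (heven : Even l₁.length) :
    b' = b ∧ ∃ i z, v = List.replicate i (b + 1) ++ z ∧ v' = z ++ List.replicate i b := by
  have hlen := congrArg List.length h
  simp only [List.length_append, List.length_singleton, length_thueMap] at hlen
  obtain ⟨v₁, v₂, rfl, rfl, rfl⟩ :=
    thueMap_append_eq_append h heven (by obtain ⟨k, hk⟩ := heven; omega)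
  have hlen' := congrArg List.length h'
  simp only [List.length_append, List.length_singleton, length_thueMap] at hlen'
  rw [List.append_assoc] at h'
  obtain ⟨y₁, y₂, rfl, hy₁, hy₂⟩ :=
    thueMap_append_eq_append h' (length_thueMap v₂ ▸ even_two_mul _)
      (by rw [length_thueMap]; omega)
  obtain rfl := thueMap_injective hy₁
  obtain ⟨rfl, hrep, hrep'⟩ := cons_thueMap_eq_thueMap_concat hy₂
  exact ⟨rfl, v₁.length, v₂, congrArg (· ++ v₂) hrep', congrArg (v₂ ++ ·) hrep⟩

theorem exists_replicate_of_isRotated_thueMap_concat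
    (h : thueMap v ++ [b] ~r thueMap v' ++ [b']) :
    b' = b ∧ ∃ i z, (v = List.replicate i (b + 1) ++ z ∧ v' = z ++ List.replicate i b) ∨
      (v' = List.replicate i (b + 1) ++ z ∧ v = z ++ List.replicate i b) := by
  obtain ⟨l₁, l₂, h₁, h₂⟩ := exists_append_of_isRotated h
  have hlen := congrArg List.length h₁
  simp only [List.length_append, List.length_singleton, length_thueMap] at hlen
  rcases Nat.even_or_odd l₁.length with heven | ⟨k, hk⟩
  · obtain ⟨rfl, i, z, hz⟩ := exists_replicate_of_thueMap_concat_eq_append h₁ h₂ heven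
    exact ⟨rfl, i, z, Or.inl hz⟩
  · have heven : Even l₂.length := ⟨v.length - k, by omega⟩
    obtain ⟨rfl, i, z, hz⟩ := exists_replicate_of_thueMap_concat_eq_append h₂ h₁ heven
    exact ⟨rfl, i, z, Or.inr hz⟩

/-- A pair `(v, b)` such that `thueMap v ++ [b]`, or its cyclic shift `b :: thueMap v`, is a factor
of the Thue–Morse word because it is a prefix of `thueMap (v ++ [b])`, respectively a suffix of
`thueMap ((b + 1) :: v)`. The pairs `((b + 1) :: z, b)` and `(z ++ [b], b)` represent the same
cyclic word; to have one pair per cyclic word, the former is excluded if the latter qualifies. -/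
def IsTerminal (v : List (Fin 2)) (b : Fin 2) : Prop :=
  (IsFactor thueMorse (v ++ [b]) ∨ IsFactor thueMorse ((b + 1) :: v)) ∧
    ∀ z, v = (b + 1) :: z → ¬ IsFactor thueMorse (z ++ [b])

theorem IsTerminal.isFactor (h : IsTerminal v b) : IsFactor thueMorse v :=
  h.1.elim IsFactor.of_append_left IsFactor.of_cons

theorem IsTerminal.eq_zero (h : IsTerminal (List.replicate i (b + 1) ++ z) b)
    (h' : IsTerminal (z ++ List.replicate i b) b) : i = 0 := by
  match i with
  | 0 => rfl
  | 1 => exact absurd h'.isFactor (h.2 z rfl)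
  | 2 =>
    rcases h'.1 with hcube | hfac
    · rw [List.append_assoc] at hcube
      exact absurd (le_two_of_isFactor_replicate (k := 3)
        (hcube.of_infix (List.suffix_append z _).isInfix)) (by norm_num)
    · refine absurd (hfac.of_infix ?_) (h.2 ((b + 1) :: z) rfl)
      exact ⟨[], [b], by simp [List.replicate]⟩
  | i + 3 =>
    have := le_two_of_isFactor_replicate h.isFactor.of_append_left
    omega

theorem IsTerminal.eq_of_isRotated (h : IsTerminal v b) (h' : IsTerminal v' b')
    (hrot : thueMap v ++ [b] ~r thueMap v' ++ [b']) : v = v' ∧ b = b' := by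
  obtain ⟨rfl, i, z, ⟨rfl, rfl⟩ | ⟨rfl, rfl⟩⟩ := exists_replicate_of_isRotated_thueMap_concat hrot
  · obtain rfl := h.eq_zero h'
    exact ⟨List.append_nil z |>.symm, rfl⟩
  · obtain rfl := h'.eq_zero h
    exact ⟨List.append_nil z, rfl⟩

theorem IsTerminal.thueMap_concat_mem_cyclicFactors (h : IsTerminal v b) :
    ((thueMap v ++ [b] : List (Fin 2)) : Cycle (Fin 2)) ∈
      cyclicFactors thueMorse (2 * v.length + 1) := by
  have hlen : (thueMap v ++ [b]).length = 2 * v.length + 1 := by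
    rw [List.length_append, length_thueMap, List.length_singleton]
  rcases h.1 with hfac | hfac
  · refine ⟨_, mem_wordFactors_iff.2 ⟨?_, hlen⟩, rfl⟩
    have := hfac.thueMap
    rw [thueMap_append, thueMap_cons, ← List.singleton_append, ← List.append_assoc] at this
    exact this.of_append_left
  · have hrot : b :: thueMap v ~r thueMap v ++ [b] := (List.isRotated_concat b (thueMap v)).symm
    have hfac' := hfac.thueMap.of_cons
    rw [fin_two_add_one_add_one] at hfac'
    exact ⟨_, mem_wordFactors_iff.2 ⟨hfac', hrot.perm.length_eq.trans hlen⟩,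
      Cycle.coe_eq_coe.2 hrot⟩

/-- The terminal pairs whose first component has length `n`. -/
def terminalPairs (n : ℕ) : Set (List (Fin 2) × Fin 2) :=
  {p | p.1.length = n ∧ IsTerminal p.1 p.2}

theorem terminalPairs_finite (n : ℕ) : (terminalPairs n).Finite :=
  ((List.finite_length_eq (Fin 2) n).prod Set.finite_univ).subset fun _ hp => ⟨hp.1, trivial⟩

theorem ncard_terminalPairs_le (n : ℕ) :
    (terminalPairs n).ncard ≤ cyclicComplexity thueMorse (2 * n + 1) := by
  refine Set.ncard_le_ncard_of_injOn
    (fun p => ((thueMap p.1 ++ [p.2] : List (Fin 2)) : Cycle (Fin 2))) ?_ ?_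
    (cyclicFactors_finite thueMorse (2 * n + 1))
  · rintro ⟨v, b⟩ ⟨rfl, hvb⟩
    exact hvb.thueMap_concat_mem_cyclicFactors
  · rintro ⟨v, b⟩ ⟨-, hvb⟩ ⟨v', b'⟩ ⟨-, hvb'⟩ h
    exact Prod.ext_iff.2 (hvb.eq_of_isRotated hvb' (Cycle.coe_eq_coe.1 h))

theorem gapCount_zero_le_ncard_terminalPairs (n : ℕ) :
    gapCount 0 (n + 1) ≤
      (terminalPairs (n + 1) ∩ {p | IsFactor thueMorse (p.1 ++ [p.2])}).ncard := by
  have hfin := (terminalPairs_finite (n + 1)).inter_of_left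
    {p | IsFactor thueMorse (p.1 ++ [p.2])}
  refine (Set.ncard_le_ncard ?_ (hfin.image fun p => p.1 ++ [p.2])).trans (Set.ncard_image_le hfin)
  intro w hw
  obtain ⟨a, v, hv, rfl, hfac⟩ := mem_gapFactors_succ.1 hw
  rw [add_zero] at hfac ⊢
  refine ⟨(a :: v, a), ⟨⟨by rw [List.length_cons, hv], Or.inl hfac, ?_⟩, hfac⟩, rfl⟩
  exact fun z hz => absurd (List.cons.inj hz).1.symm (fin_two_add_one_ne a)

theorem isTerminal_of_notMem_rightSpecialFactors {c : Fin 2}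
    (h : IsFactor thueMorse ((b + 1) :: c :: (z ++ [b + 1])))
    (hz : z ∉ rightSpecialFactors thueMorse z.length) :
    IsTerminal (c :: z) b ∧ ¬ IsFactor thueMorse (c :: z ++ [b]) := by
  have hzb : ¬ IsFactor thueMorse (z ++ [b]) := by
    refine fun hzb => hz fun d => mem_wordFactors_iff.2 ⟨?_, by simp⟩
    rcases eq_or_ne d b with rfl | hd
    · exact hzb
    · exact fin_two_ne_iff.1 hd ▸ h.of_cons.of_cons
  refine ⟨⟨Or.inr (IsFactor.of_append_left (s := [b + 1]) h), ?_⟩, fun hczb => hzb hczb.of_cons⟩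
  rintro _ hcz
  rwa [← (List.cons.inj hcz).2]

theorem gapCount_zero_add_two_le (n : ℕ) :
    gapCount 0 (n + 2) ≤
      (terminalPairs (n + 1) \ {p | IsFactor thueMorse (p.1 ++ [p.2])}).ncard +
        4 * (rightSpecialFactors thueMorse n).ncard := by
  let f (p : List (Fin 2) × Fin 2) : List (Fin 2) := (p.2 + 1) :: (p.1 ++ [p.2 + 1])
  let g (p : (Fin 2 × Fin 2) × List (Fin 2)) : List (Fin 2) := p.1.1 :: p.1.2 :: (p.2 ++ [p.1.1])
  let R := (Set.univ : Set (Fin 2 × Fin 2)) ×ˢ rightSpecialFactors thueMorse n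
  have hT := (terminalPairs_finite (n + 1)).sdiff (t := {p | IsFactor thueMorse (p.1 ++ [p.2])})
  have hR : R.Finite := Set.finite_univ.prod (rightSpecialFactors_finite thueMorse n)
  have hRcard : R.ncard = 4 * (rightSpecialFactors thueMorse n).ncard := by
    rw [Set.ncard_prod, Set.ncard_univ, Nat.card_prod, Nat.card_fin]
  suffices hcover : gapFactors 0 (n + 2) ⊆ f '' (terminalPairs (n + 1) \ _) ∪ g '' R from
    hRcard ▸ ((Set.ncard_le_ncard hcover ((hT.image f).union (hR.image g))).trans
      (Set.ncard_union_le _ _)).trans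
        (Nat.add_le_add (Set.ncard_image_le hT) (Set.ncard_image_le hR))
  intro w hw
  obtain ⟨a, v, hv, rfl, hfac⟩ := mem_gapFactors_succ.1 hw
  obtain ⟨c, z, rfl⟩ := List.exists_cons_of_length_eq_add_one hv
  obtain rfl : z.length = n := Nat.succ_injective hv
  rw [add_zero] at hfac ⊢
  by_cases hz : z ∈ rightSpecialFactors thueMorse z.length
  · exact Or.inr ⟨((a, c), z), ⟨trivial, hz⟩, rfl⟩
  · rw [← fin_two_add_one_add_one a] at hfac ⊢
    obtain ⟨hterm, hnot⟩ := isTerminal_of_notMem_rightSpecialFactors hfac hz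
    exact Or.inl ⟨(c :: z, a + 1), ⟨⟨rfl, hterm⟩, hnot⟩, rfl⟩

theorem gapCount_one_le_cyclicComplexity_of_odd (n : ℕ) :
    gapCount 1 (2 * (n + 1) + 1) ≤ cyclicComplexity thueMorse (2 * (n + 1) + 1) +
      4 * (rightSpecialFactors thueMorse n).ncard := by
  rw [gapCount_one_two_mul_add_one (n := n + 1) (by omega)]
  have hfactor := gapCount_zero_le_ncard_terminalPairs n
  have hnot : gapCount 0 (n + 1 + 1) ≤ _ := gapCount_zero_add_two_le n
  have hsplit := Set.ncard_inter_add_ncard_sdiff_eq_ncard (terminalPairs (n + 1))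
    {p | IsFactor thueMorse (p.1 ++ [p.2])} (terminalPairs_finite (n + 1))
  have hterminal := ncard_terminalPairs_le (n + 1)
  omega

end OddLength

/-! ### Asymptotics of the cyclic complexity -/

theorem gapCount_one_le_cyclicComplexity {n : ℕ} (hn : 1 ≤ n) :
    gapCount 1 n ≤ cyclicComplexity thueMorse n + 16 := by
  induction n, hn using halving_induction with
  | one => rw [gapCount_one]; omega
  | two => rw [gapCount_one_two]; omega
  | even m hm ih _ =>
    rw [gapCount_two_mul 1 hm]
    obtain rfl | rfl | hm' : m = 2 ∨ m = 3 ∨ 4 ≤ m := by omega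
    · rw [gapCount_one_two]; omega
    · rw [gapCount_one_three]; omega
    · rw [cyclicComplexity_two_mul hm']; omega
  | odd m hm _ _ =>
    obtain rfl | rfl | hm' : m = 1 ∨ m = 2 ∨ 3 ≤ m := by omega
    · rw [gapCount_one_three]; omega
    · rw [gapCount_one_two_mul_add_one hm, gapCount_zero_two, gapCount_zero_three]; omega
    · obtain ⟨k, rfl⟩ := Nat.exists_eq_add_of_le' hm
      have hodd := gapCount_one_le_cyclicComplexity_of_odd k
      have hspecial := ncard_rightSpecialFactors_thueMorse_le (n := k) (by omega)
      omega

theorem four_mul_le_three_mul_cyclicComplexity (n : ℕ) :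
    4 * n ≤ 3 * cyclicComplexity thueMorse n + 48 := by
  obtain rfl | hn := Nat.eq_zero_or_pos n
  · omega
  · have hgap := (gapCount_lower_bounds hn).2.2.1
    have hcyclic := gapCount_one_le_cyclicComplexity hn
    omega

theorem cyclicComplexity_six_mul_two_pow_le (j : ℕ) :
    cyclicComplexity thueMorse (6 * 2 ^ j) ≤ 8 * 2 ^ j + cyclicComplexity thueMorse 6 := by
  induction j with
  | zero => exact Nat.le_add_left _ _
  | succ j ih =>
    have hpow := Nat.one_le_two_pow (n := j)
    rw [show 6 * 2 ^ (j + 1) = 2 * (6 * 2 ^ j) by ring, cyclicComplexity_two_mul (by omega),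
      gapCount_one_six_mul_two_pow, pow_succ]
    omega

section LiminfDiv

open Filter Topology

variable {a : ℕ → ℝ} {L C : ℝ}

theorem tendsto_coe_add_div_atTop (L C : ℝ) :
    Tendsto (fun n : ℕ => ((L + C / n : ℝ) : EReal)) atTop (𝓝 (L : EReal)) := by
  have h : Tendsto (fun n : ℕ => L + C / n) atTop (𝓝 (L + 0)) :=
    (tendsto_const_div_atTop_nhds_zero_nat C).const_add L
  rw [add_zero] at h
  exact EReal.tendsto_coe.2 h

theorem coe_le_liminf_div (h : ∀ᶠ n : ℕ in atTop, L * n ≤ a n + C) :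
    (L : EReal) ≤ liminf (fun n : ℕ => ((a n / n : ℝ) : EReal)) atTop := by
  rw [← (tendsto_coe_add_div_atTop L (-C)).liminf_eq]
  refine liminf_le_liminf ?_
  filter_upwards [h, eventually_gt_atTop 0] with n hn hpos
  have hpos' : (0 : ℝ) < n := Nat.cast_pos.2 hpos
  rw [EReal.coe_le_coe_iff, le_div_iff₀ hpos', add_mul, div_mul_cancel₀ _ hpos'.ne']
  linarith

theorem liminf_div_le_coe {φ : ℕ → ℕ} (hφ : Tendsto φ atTop atTop)
    (h : ∀ j, a (φ j) ≤ L * φ j + C) :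
    liminf (fun n : ℕ => ((a n / n : ℝ) : EReal)) atTop ≤ (L : EReal) := by
  rw [← ((tendsto_coe_add_div_atTop L C).comp hφ).liminf_eq]
  refine (liminf_le_liminf_of_le hφ).trans ?_
  rw [← Function.comp_def, ← liminf_comp]
  refine liminf_le_liminf ?_
  filter_upwards [hφ.eventually_gt_atTop 0] with j hpos
  have hpos' : (0 : ℝ) < φ j := Nat.cast_pos.2 hpos
  dsimp only [Function.comp_apply]
  rw [EReal.coe_le_coe_iff, div_le_iff₀ hpos', add_mul, div_mul_cancel₀ _ hpos'.ne']
  exact h j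

end LiminfDiv

theorem corollary7 :
    Filter.liminf (fun n : ℕ => (((cyclicComplexity thueMorse n : ℝ) / (n : ℝ) : ℝ) : EReal))
      Filter.atTop = ((4 / 3 : ℝ) : EReal) := by
  refine le_antisymm (liminf_div_le_coe (φ := fun j => 6 * 2 ^ j)
    (C := cyclicComplexity thueMorse 6) ?_ fun j => ?_) (coe_le_liminf_div (C := 16) ?_)
  · exact (tendsto_pow_atTop_atTop_of_one_lt one_lt_two).const_mul_atTop' (by norm_num)
  · have hupper : (cyclicComplexity thueMorse (6 * 2 ^ j) : ℝ) ≤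
        8 * 2 ^ j + cyclicComplexity thueMorse 6 := by
      exact_mod_cast cyclicComplexity_six_mul_two_pow_le j
    push_cast
    linarith
  · refine Filter.Eventually.of_forall fun n => ?_
    have hlower : (4 * n : ℝ) ≤ 3 * cyclicComplexity thueMorse n + 48 := by
      exact_mod_cast four_mul_le_three_mul_cyclicComplexity n
    linarith
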